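/- Let $T>0$, let $C_0[0,T]$ be the space of continuous $x:[0,T]\to\mathbb R$ with $x(0)=0$, and let $m$ be Wiener measure on it, i.e. the (completed) Borel probability measure under which $(x(t))_{0\le t\le T}$ is a centred Gaussian process with covariance $\min(s,t)$. Fix a complete orthonormal sequence $(\varphi_k)_{k\ge0}$ of $L_2[0,T]$ consisting of functions of bounded variation. For $v\in L_2[0,T]$ and $x\in C_0[0,T]$ the Paley–Wiener–Zygmund (PWZ) stochastic integral is $$\langle v,x\rangle=\lim_{N\to\infty}\int_0^T\sum_{k<N}(v,\varphi_k)_{L_2}\,\varphi_k(t)\,dx(t)$$ (Riemann–Stieltjes integrals) for those $x$ for which the limit exists. Let $\alpha_1,\dots,\alpha_n$ be orthonormal in $L_2[0,T]$, let $p_1,\dots,p_n$ be nonnegative integers, and let $F(x)=\prod_{j=1}^n\langle\alpha_j,x\rangle^{2p_j}$. Let $\gamma,\beta$ be nonzero real numbers. Then for every $y\in C_0[0,T]$ for which all $\langle\alpha_j,y\rangle$ exist, the integrals $\langle\alpha_j,\gamma x+\beta y\rangle$, $1\le j\le n$, exist for $m$-almost every $x$, the functional $x\mapsto F(\gamma x+\beta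 y)$ is $m$-integrable, and $$\int_{C_0[0,T]}F(\gamma x+\beta y)\,m(dx)=\prod_{j=1}^n\Bigl[\sum_{s=0}^{p_j}\binom{2p_j}{2s}(2s-1)!!\,\gamma^{2s}\beta^{2p_j-2s}\langle\alpha_j,y\rangle^{2p_j-2s}\Bigr],$$ where $(-1)!!=1$. Moreover, this applies to scale-invariant almost every $y$: for every $\rho>0$, all $\langle\alpha_j,\rho y\rangle$ exist for $m$-almost every $y\in C_0[0,T]$. -/

import Mathlib

open MeasureTheory ProbabilityTheory Filter Topology

/-- The one-parameter Wiener space `C₀[0,T]`: the continuous functions `x : [0,T] → ℝ` with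
`x 0 = 0`, with the sup norm. -/
def WienerSpace (T : ℝ) : Submodule ℝ C(Set.Icc (0 : ℝ) T, ℝ) where
  carrier := {x | ∀ t : Set.Icc (0 : ℝ) T, (t : ℝ) = 0 → x t = 0}
  add_mem' := by
    intro x y hx hy t ht
    simp [hx t ht, hy t ht]
  zero_mem' := by
    intro t _
    rfl
  smul_mem' := by
    intro c x hx t ht
    simp [hx t ht]

/-- The Borel σ-algebra of `C₀[0,T]`. -/
instance WienerSpace.instMeasurableSpace (T : ℝ) : MeasurableSpace (WienerSpace T) :=
  borel (WienerSpace T)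

instance WienerSpace.instBorelSpace (T : ℝ) : BorelSpace (WienerSpace T) := ⟨rfl⟩

/-- `m` is Wiener measure on `C₀[0,T]`: the probability measure under which the coordinate
process `(t, x) ↦ x t` is a centred Gaussian process with covariance `min s t`. -/
structure IsWienerMeasure {T : ℝ} (m : Measure (WienerSpace T)) : Prop where
  isProbabilityMeasure : IsProbabilityMeasure m
  isGaussianProcess :
    IsGaussianProcess (fun (t : Set.Icc (0 : ℝ) T) (x : WienerSpace T) => x.1 t) m
  mean_eq : ∀ t : Set.Icc (0 : ℝ) T, ∫ x : WienerSpace T, x.1 t ∂m = 0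
  covariance_eq : ∀ s t : Set.Icc (0 : ℝ) T,
    covariance (fun x : WienerSpace T => x.1 s) (fun x : WienerSpace T => x.1 t) m
      = min (s : ℝ) (t : ℝ)

/-- A property of paths holds scale-invariant almost everywhere (s-a.e.) with respect to `m`:
for every `ρ > 0` the exceptional set, rescaled by `ρ`, is `m`-null. -/
def HoldsScaleInvariantAE {T : ℝ} (m : Measure (WienerSpace T)) (P : WienerSpace T → Prop) :
    Prop :=
  ∀ ρ : ℝ, 0 < ρ → m {x | ¬ P (ρ • x)} = 0

/-- The real Hilbert space `L₂[0,T]`. -/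
abbrev L2Space (T : ℝ) : Type := Lp ℝ 2 (volume.restrict (Set.Icc (0 : ℝ) T))

/-- `c` is the Riemann–Stieltjes integral `∫_a^b f dg`: the limit, as the mesh of the partition
`a = t₀ ≤ t₁ ≤ ⋯ ≤ t_n = b` tends to zero, of `∑ f(ξ_i) (g(t_{i+1}) - g(t_i))` with arbitrary
tags `ξ_i ∈ [t_i, t_{i+1}]`. -/
def HasRSIntegral (a b : ℝ) (f : ℝ → ℝ) (g : Set.Icc a b → ℝ) (c : ℝ) : Prop :=
  ∀ ε : ℝ, 0 < ε → ∃ δ : ℝ, 0 < δ ∧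
    ∀ (n : ℕ) (t ξ : ℕ → Set.Icc a b), Monotone t → (t 0 : ℝ) = a → (t n : ℝ) = b →
      (∀ i < n, (t (i + 1) : ℝ) - (t i : ℝ) < δ) →
      (∀ i < n, t i ≤ ξ i ∧ ξ i ≤ t (i + 1)) →
      |(∑ i ∈ Finset.range n, f (ξ i) * (g (t (i + 1)) - g (t i))) - c| < ε

open Classical in
/-- The Riemann–Stieltjes integral `∫_a^b f dg` (and `0` if it does not exist). -/
noncomputable def rsIntegral (a b : ℝ) (f : ℝ → ℝ) (g : Set.Icc a b → ℝ) : ℝ :=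
  if h : ∃ c : ℝ, HasRSIntegral a b f g c then h.choose else 0

/-- A complete orthonormal sequence of `L₂[0,T]` all of whose members are functions of bounded
variation on `[0,T]`: the elements `basis k` of `L₂[0,T]` and functions `fn k` representing
them. -/
structure BVOrthonormalBasis (T : ℝ) where
  basis : HilbertBasis ℕ ℝ (L2Space T)
  fn : ℕ → ℝ → ℝ
  boundedVariationOn : ∀ k, BoundedVariationOn (fn k) (Set.Icc (0 : ℝ) T)
  ae_eq : ∀ k, (basis k : ℝ → ℝ) =ᵐ[volume.restrict (Set.Icc (0 : ℝ) T)] fn k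

/-- The `N`-th approximation `∫_0^T ∑_{k<N} (v, φ_k) φ_k(t) dx(t)` of the
Paley–Wiener–Zygmund integral, with `φ` the given complete orthonormal sequence. -/
noncomputable def pwzApprox {T : ℝ} (φ : BVOrthonormalBasis T) (v : L2Space T)
    (x : WienerSpace T) (N : ℕ) : ℝ :=
  rsIntegral 0 T (fun t => ∑ k ∈ Finset.range N, inner ℝ v (φ.basis k) * φ.fn k t) x.1

/-- The Paley–Wiener–Zygmund integral `⟨v, x⟩` exists. -/
def PWZExists {T : ℝ} (φ : BVOrthonormalBasis T) (v : L2Space T) (x : WienerSpace T) : Prop :=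
  ∃ c : ℝ, Tendsto (pwzApprox φ v x) atTop (𝓝 c)

/-- The Paley–Wiener–Zygmund stochastic integral
`⟨v, x⟩ = lim_N ∫_0^T ∑_{k<N} (v, φ_k) φ_k(t) dx(t)`, for the paths `x` for which the limit
exists. -/
noncomputable def pwz {T : ℝ} (φ : BVOrthonormalBasis T) (v : L2Space T) (x : WienerSpace T) : ℝ :=
  limUnder atTop (pwzApprox φ v x)

/-- The functional `F(x) = ∏_j ⟨α_j, x⟩^{2 p_j}`. -/
noncomputable def polyFunctional {T : ℝ} (φ : BVOrthonormalBasis T) {n : ℕ}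
    (α : Fin n → L2Space T) (p : Fin n → ℕ) (x : WienerSpace T) : ℝ :=
  ∏ j, pwz φ (α j) x ^ (2 * p j)

/-! Under Wiener measure the integrals ⟨α_j, x⟩ are independent standard Gaussian variables. The
approximations are linear in the path, so for almost every x one has ⟨α_j, γx + βy⟩ = γ⟨α_j, x⟩ +
d_j with the constant d_j = β⟨α_j, y⟩. Hence the integral of the product factors into the moments
E(γZ + d_j)^{2p_j} of a standard Gaussian Z; in the binomial expansion the odd moments vanish and
the even ones are double factorials.

The work lies in the Gaussian law. For f of bounded variation, ∫ f dx exists for every path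
(`exists_hasRSIntegral`); its Riemann–Stieltjes sums are combinations of uncorrelated jointly
Gaussian increments, so in the limit it is N(0, ∫ f²) (`map_rsIntegral_eq_gaussianReal`). Applied to
finite combinations of the φ_k, this makes the ∫ φ_k dx independent standard Gaussians, and the
approximations of ⟨v, x⟩ become partial sums of a Gaussian series with coefficients (v, φ_k). These
converge almost surely by martingale convergence (`ae_exists_tendsto_sum_of_gaussian`). By Parseval,
∑ c_j ⟨α_j, x⟩ is N(0, ∑ c_j²) (`isStdGaussianFamily_pwz`), and characteristic functions turn this
into independence. -/

/-! ### Riemann–Stieltjes integrals as limits along a filter of partitions -/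

/-- The Riemann–Stieltjes sum of `f` against `g`, for partition points `P.2.1` (of which the first
`P.1 + 1` are used) and tags `P.2.2`. -/
def rsSum {a b : ℝ} (f : ℝ → ℝ) (g : Set.Icc a b → ℝ)
    (P : ℕ × (ℕ → Set.Icc a b) × (ℕ → Set.Icc a b)) : ℝ :=
  ∑ i ∈ Finset.range P.1, f (P.2.2 i) * (g (P.2.1 (i + 1)) - g (P.2.1 i))

/-- `P` is a tagged partition of `[a, b]` of mesh less than `δ`. -/
structure IsTaggedPartition {a b : ℝ} (δ : ℝ)
    (P : ℕ × (ℕ → Set.Icc a b) × (ℕ → Set.Icc a b)) : Prop where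
  mono : Monotone P.2.1
  first : (P.2.1 0 : ℝ) = a
  last : (P.2.1 P.1 : ℝ) = b
  mesh : ∀ i < P.1, (P.2.1 (i + 1) : ℝ) - (P.2.1 i : ℝ) < δ
  tag : ∀ i < P.1, P.2.1 i ≤ P.2.2 i ∧ P.2.2 i ≤ P.2.1 (i + 1)

lemma IsTaggedPartition.weaken {a b δ δ' : ℝ} {P : ℕ × (ℕ → Set.Icc a b) × (ℕ → Set.Icc a b)}
    (h : IsTaggedPartition δ P) (hδ : δ ≤ δ') : IsTaggedPartition δ' P :=
  ⟨h.mono, h.first, h.last, fun i hi => (h.mesh i hi).trans_le hδ, h.tag⟩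

/-- The filter of tagged partitions of `[a, b]` whose mesh tends to zero. -/
def meshFilter (a b : ℝ) : Filter (ℕ × (ℕ → Set.Icc a b) × (ℕ → Set.Icc a b)) :=
  ⨅ δ ∈ Set.Ioi (0 : ℝ), 𝓟 {P | IsTaggedPartition δ P}

lemma meshFilter_hasBasis (a b : ℝ) :
    (meshFilter a b).HasBasis (fun δ : ℝ => 0 < δ) fun δ => {P | IsTaggedPartition δ P} := by
  refine hasBasis_biInf_principal ?_ ⟨1, Set.mem_Ioi.2 one_pos⟩
  intro x hx y hy
  exact ⟨min x y, Set.mem_Ioi.2 (lt_min hx hy), fun P hP => hP.weaken (min_le_left _ _),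
    fun P hP => hP.weaken (min_le_right _ _)⟩

/-- Makes uniqueness of limits, limit arithmetic and completeness of ℝ available for the ε-δ
definition. -/
lemma hasRSIntegral_iff_tendsto {a b : ℝ} {f : ℝ → ℝ} {g : Set.Icc a b → ℝ} {c : ℝ} :
    HasRSIntegral a b f g c ↔ Tendsto (rsSum f g) (meshFilter a b) (𝓝 c) := by
  rw [(meshFilter_hasBasis a b).tendsto_iff Metric.nhds_basis_ball]
  refine forall₂_congr fun ε _ => exists_congr fun δ => and_congr_right fun _ => ?_
  constructor
  · rintro h ⟨n, t, ξ⟩ hP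
    exact h n t ξ hP.mono hP.first hP.last hP.mesh hP.tag
  · intro h n t ξ h1 h2 h3 h4 h5
    exact h (n, t, ξ) ⟨h1, h2, h3, h4, h5⟩

/-- The partition of `[a, b]` into `k + 1` intervals of equal length, tagged at the left. -/
noncomputable def uniformPartition {a b : ℝ} (hab : a ≤ b) (k : ℕ) :
    ℕ × (ℕ → Set.Icc a b) × (ℕ → Set.Icc a b) :=
  -- The projection keeps the points equal to b beyond index k + 1, since monotonicity is required
  -- on all of ℕ.
  (k + 1, fun i => Set.projIcc a b hab (a + i * ((b - a) / (k + 1))),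
    fun i => Set.projIcc a b hab (a + i * ((b - a) / (k + 1))))

lemma uniformPartition_monotone {a b : ℝ} (hab : a ≤ b) (k : ℕ) :
    Monotone (uniformPartition hab k).2.1 := by
  intro i j hij
  refine Set.monotone_projIcc hab ?_
  have : 0 ≤ (b - a) / (k + 1) := div_nonneg (by linarith) (by positivity)
  have hij' : (i : ℝ) ≤ j := by exact_mod_cast hij
  gcongr

lemma isTaggedPartition_uniformPartition {a b : ℝ} (hab : a ≤ b) (k : ℕ) {δ : ℝ}
    (hδ : (b - a) / (k + 1) < δ) : IsTaggedPartition δ (uniformPartition hab k) := by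
  have h0 : 0 ≤ (b - a) / (k + 1) := div_nonneg (by linarith) (by positivity)
  have hval : ∀ i ≤ k + 1, ((uniformPartition hab k).2.1 i : ℝ) = a + i * ((b - a) / (k + 1)) := by
    intro i hi
    have h1 : (i : ℝ) * ((b - a) / (k + 1)) ≤ b - a := by
      calc (i : ℝ) * ((b - a) / (k + 1)) ≤ (k + 1) * ((b - a) / (k + 1)) := by
            gcongr; exact_mod_cast hi
        _ = b - a := by field_simp
    have h2 : 0 ≤ (i : ℝ) * ((b - a) / (k + 1)) := by positivity
    simp only [uniformPartition]
    rw [Set.projIcc_of_mem hab ⟨by linarith, by linarith⟩]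
  have hm := uniformPartition_monotone hab k
  refine ⟨hm, ?_, ?_, ?_, ?_⟩
  · rw [hval 0 (by simp)]; simp
  · change ((uniformPartition hab k).2.1 (k + 1) : ℝ) = b
    rw [hval _ le_rfl]; push_cast; field_simp; ring
  · intro i hi
    change i < k + 1 at hi
    rw [hval _ hi, hval _ hi.le]
    push_cast
    linarith
  · intro i hi
    exact ⟨le_rfl, hm i.le_succ⟩

lemma tendsto_uniformPartition {a b : ℝ} (hab : a ≤ b) :
    Tendsto (uniformPartition hab) atTop (meshFilter a b) := by
  rw [(meshFilter_hasBasis a b).tendsto_right_iff]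
  intro δ hδ
  have h : Tendsto (fun k : ℕ => (b - a) / ((k : ℝ) + 1)) atTop (𝓝 0) :=
    tendsto_const_nhds.div_atTop (tendsto_atTop_add_const_right _ _ tendsto_natCast_atTop_atTop)
  filter_upwards [h.eventually_lt_const hδ] with k hk
  exact isTaggedPartition_uniformPartition hab k hk

/-- Needed for uniqueness of limits, hence for identifying the value chosen in `rsIntegral`. -/
lemma meshFilter_neBot {a b : ℝ} (hab : a ≤ b) : (meshFilter a b).NeBot :=
  (tendsto_uniformPartition hab).neBot

lemma HasRSIntegral.rsIntegral_eq {a b : ℝ} (hab : a ≤ b) {f : ℝ → ℝ} {g : Set.Icc a b → ℝ} {c : ℝ}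
    (h : HasRSIntegral a b f g c) : rsIntegral a b f g = c := by
  have := meshFilter_neBot hab
  have hex : ∃ c, HasRSIntegral a b f g c := ⟨c, h⟩
  rw [rsIntegral, dif_pos hex]
  exact tendsto_nhds_unique (hasRSIntegral_iff_tendsto.1 hex.choose_spec)
    (hasRSIntegral_iff_tendsto.1 h)

/-! ### Existence and linearity for integrands of bounded variation -/

lemma BoundedVariationOn.abs_le_add_eVariationOn {a b : ℝ} {f : ℝ → ℝ}
    (hf : BoundedVariationOn f (Set.Icc a b)) {x : ℝ} (hx : x ∈ Set.Icc a b) :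
    |f x| ≤ |f a| + (eVariationOn f (Set.Icc a b)).toReal := by
  have h := hf.dist_le hx (Set.left_mem_Icc.2 (hx.1.trans hx.2))
  rw [Real.dist_eq] at h
  linarith [abs_sub_abs_le_abs_sub (f x) (f a)]

/-- Abel summation: it moves the differences onto the integrand, whose variation is controlled,
while the continuous integrator may have unbounded variation. -/
lemma sum_range_mul_sub_by_parts (u G : ℕ → ℝ) (n : ℕ) :
    ∑ i ∈ Finset.range n, u i * (G (i + 1) - G i) =
      u n * G n - u 0 * G 0 - ∑ i ∈ Finset.range n, G (i + 1) * (u (i + 1) - u i) := by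
  induction n with
  | zero => simp
  | succ n ih => rw [Finset.sum_range_succ, Finset.sum_range_succ, ih]; ring

lemma BoundedVariationOn.sum_abs_sub_le {s : Set ℝ} {f : ℝ → ℝ} (hf : BoundedVariationOn f s)
    {u : ℕ → ℝ} (hu : Monotone u) (us : ∀ i, u i ∈ s) (n : ℕ) :
    ∑ i ∈ Finset.range n, |f (u (i + 1)) - f (u i)| ≤ (eVariationOn f s).toReal := by
  have h := eVariationOn.sum_le (f := f) (n := n) hu us
  rw [← ENNReal.ofReal_le_iff_le_toReal hf, ENNReal.ofReal_sum_of_nonneg fun _ _ => abs_nonneg _]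
  refine (Finset.sum_le_sum fun i _ => ?_).trans h
  rw [edist_dist, Real.dist_eq]

/-- A Riemann–Stieltjes sum of a function of bounded variation is bounded by a multiple of the
sup norm of the integrator. -/
lemma abs_rsSum_le {a b : ℝ} {f : ℝ → ℝ} (hf : BoundedVariationOn f (Set.Icc a b))
    {g : Set.Icc a b → ℝ} {M : ℝ} (hg : ∀ t, |g t| ≤ M) {δ : ℝ}
    {P : ℕ × (ℕ → Set.Icc a b) × (ℕ → Set.Icc a b)} (hP : IsTaggedPartition δ P) :
    |rsSum f g P| ≤ (2 * |f a| + 3 * (eVariationOn f (Set.Icc a b)).toReal) * M := by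
  obtain ⟨n, t, ξ⟩ := P
  obtain ⟨hm, h0, hn, -, htag⟩ := hP
  simp only at hm h0 hn htag
  set V := (eVariationOn f (Set.Icc a b)).toReal
  -- The tags are continued by the endpoint b, which keeps them monotone and supplies the extra
  -- value η n in the summation by parts. Each boundary term costs (|f a| + V) M and the remaining
  -- sum V M.
  set η : ℕ → Set.Icc a b := fun i => if i < n then ξ i else t n with hη
  have hηm : Monotone η := by
    refine monotone_nat_of_le_succ fun i => ?_
    simp only [hη]
    split_ifs with h1 h2 h2
    · exact (htag i h1).2.trans (htag _ h2).1
    · exact (htag i h1).2.trans (hm h1)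
    · omega
    · exact le_rfl
  have hsum : rsSum f g (n, t, ξ) =
      ∑ i ∈ Finset.range n, f (η i) * (g (t (i + 1)) - g (t i)) := by
    refine Finset.sum_congr rfl fun i hi => ?_
    simp [hη, Finset.mem_range.1 hi]
  rw [hsum, sum_range_mul_sub_by_parts (fun i => f (η i)) (fun i => g (t i))]
  have hM : 0 ≤ M := (abs_nonneg _).trans (hg (t 0))
  have hb : ∀ i j, |f (η i) * g (t j)| ≤ (|f a| + V) * M := by
    intro i j
    rw [abs_mul]
    exact mul_le_mul (hf.abs_le_add_eVariationOn (η i).2) (hg _) (abs_nonneg _)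
      (add_nonneg (abs_nonneg _) ENNReal.toReal_nonneg)
  have hs : |∑ i ∈ Finset.range n, g (t (i + 1)) * (f (η (i + 1)) - f (η i))| ≤ V * M := by
    calc |∑ i ∈ Finset.range n, g (t (i + 1)) * (f (η (i + 1)) - f (η i))|
        ≤ ∑ i ∈ Finset.range n, |g (t (i + 1)) * (f (η (i + 1)) - f (η i))| :=
          Finset.abs_sum_le_sum_abs _ _
      _ ≤ ∑ i ∈ Finset.range n, M * |f (η (i + 1)) - f (η i)| := by
          refine Finset.sum_le_sum fun i _ => ?_
          rw [abs_mul]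
          exact mul_le_mul_of_nonneg_right (hg _) (abs_nonneg _)
      _ = M * ∑ i ∈ Finset.range n, |f (η (i + 1)) - f (η i)| := by rw [Finset.mul_sum]
      _ ≤ V * M := by
          rw [mul_comm V]
          exact mul_le_mul_of_nonneg_left
            (hf.sum_abs_sub_le (u := fun i => (η i : ℝ)) (fun i j h => hηm h)
              (fun i => (η i).2) n) hM
  have h1 := abs_le.1 (hb n n)
  have h2 := abs_le.1 (hb 0 0)
  have h3 := abs_le.1 hs
  rw [abs_le]
  constructor <;> nlinarith [h1.1, h1.2, h2.1, h2.2, h3.1, h3.2]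

lemma BoundedVariationOn.intervalIntegrable {a b : ℝ} (hab : a ≤ b) {f : ℝ → ℝ}
    (hf : BoundedVariationOn f (Set.Icc a b)) : IntervalIntegrable f volume a b := by
  obtain ⟨p, q, hp, hq, rfl⟩ := hf.locallyBoundedVariationOn.exists_monotoneOn_sub_monotoneOn
  rw [← Set.uIcc_of_le hab] at hp hq
  exact hp.intervalIntegrable.sub hq.intervalIntegrable

/-- Riemann–Stieltjes integrals of functions of bounded variation against polynomials. -/
lemma tendsto_rsSum_polynomial {a b : ℝ} (hab : a ≤ b) {f : ℝ → ℝ}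
    (hf : BoundedVariationOn f (Set.Icc a b)) (p : Polynomial ℝ) :
    Tendsto (rsSum f fun t : Set.Icc a b => p.eval (t : ℝ)) (meshFilter a b)
      (𝓝 (∫ t in a..b, f t * p.derivative.eval t)) := by
  obtain ⟨D, hD⟩ : ∃ D, ∀ x ∈ Set.Icc a b, |p.derivative.eval x| ≤ D := by
    obtain ⟨D, hD⟩ := (isCompact_Icc (a := a) (b := b)).exists_bound_of_continuousOn
      p.derivative.continuous.continuousOn
    exact ⟨D, fun x hx => hD x hx⟩
  have hD0 : 0 ≤ D := (abs_nonneg _).trans (hD a ⟨le_rfl, hab⟩)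
  set V := (eVariationOn f (Set.Icc a b)).toReal
  -- On each subinterval f deviates from its value at the tag by at most its variation there, while
  -- |p'| ≤ D. Additivity of the variation sums these errors to D δ V.
  have key : ∀ δ : ℝ, 0 < δ → ∀ P, IsTaggedPartition (a := a) (b := b) δ P →
      |rsSum f (fun t : Set.Icc a b => p.eval (t : ℝ)) P -
        ∫ t in a..b, f t * p.derivative.eval t| ≤ D * δ * V := by
    rintro δ hδ ⟨n, t, ξ⟩ ⟨hm, h0, hn, hmesh, htag⟩
    simp only at hm h0 hn hmesh htag
    have hle : ∀ i, (t i : ℝ) ≤ t (i + 1) := fun i => hm i.le_succ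
    have hsub : ∀ i, Set.Icc (t i : ℝ) (t (i + 1)) ⊆ Set.Icc a b := fun i =>
      Set.Icc_subset_Icc (t i).2.1 (t (i + 1)).2.2
    have hfi : ∀ i, IntervalIntegrable f volume (t i) (t (i + 1)) := fun i =>
      (hf.mono (hsub i)).intervalIntegrable (hle i)
    have hpc : Continuous fun x => p.derivative.eval x := p.derivative.continuous
    have hfp : ∀ i, IntervalIntegrable (fun x => f x * p.derivative.eval x) volume
        (t i) (t (i + 1)) := fun i => (hfi i).mul_continuousOn hpc.continuousOn
    have hcp : ∀ i, IntervalIntegrable (fun x => f (ξ i) * p.derivative.eval x) volume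
        (t i) (t (i + 1)) := fun i => (hpc.intervalIntegrable _ _).const_mul _
    have hint : ∫ x in a..b, f x * p.derivative.eval x =
        ∑ i ∈ Finset.range n, ∫ x in (t i : ℝ)..t (i + 1), f x * p.derivative.eval x := by
      rw [intervalIntegral.sum_integral_adjacent_intervals fun i _ => hfp i, h0, hn]
    have hterm : ∀ i, f (ξ i) * (p.eval (t (i + 1) : ℝ) - p.eval (t i : ℝ)) =
        ∫ x in (t i : ℝ)..t (i + 1), f (ξ i) * p.derivative.eval x := by
      intro i
      rw [intervalIntegral.integral_const_mul,
        intervalIntegral.integral_eq_sub_of_hasDerivAt (fun x _ => p.hasDerivAt x)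
          (hpc.intervalIntegrable _ _)]
    have hbound : ∀ i ∈ Finset.range n,
        |f (ξ i) * (p.eval (t (i + 1) : ℝ) - p.eval (t i : ℝ)) -
          ∫ x in (t i : ℝ)..t (i + 1), f x * p.derivative.eval x| ≤
        D * δ * (eVariationOn f (Set.Icc (t i : ℝ) (t (i + 1)))).toReal := by
      intro i hi
      rw [Finset.mem_range] at hi
      rw [hterm, ← intervalIntegral.integral_sub (hcp i) (hfp i)]
      have hvi : BoundedVariationOn f (Set.Icc (t i : ℝ) (t (i + 1))) := hf.mono (hsub i)
      have := intervalIntegral.norm_integral_le_of_norm_le_const (a := (t i : ℝ))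
        (b := t (i + 1)) (f := fun x => f (ξ i) * p.derivative.eval x - f x * p.derivative.eval x)
        (C := (eVariationOn f (Set.Icc (t i : ℝ) (t (i + 1)))).toReal * D) (by
          intro x hx
          rw [Set.uIoc_of_le (hle i)] at hx
          have hx' := Set.Ioc_subset_Icc_self hx
          rw [← sub_mul, Real.norm_eq_abs, abs_mul]
          exact mul_le_mul (hvi.dist_le ⟨(htag i hi).1, (htag i hi).2⟩ hx') (hD x (hsub i hx'))
            (abs_nonneg _) ENNReal.toReal_nonneg)
      rw [Real.norm_eq_abs, abs_of_nonneg (sub_nonneg.2 (hle i))] at this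
      refine this.trans ?_
      have hV0 : 0 ≤ (eVariationOn f (Set.Icc (t i : ℝ) (t (i + 1)))).toReal :=
        ENNReal.toReal_nonneg
      calc _ ≤ (eVariationOn f (Set.Icc (t i : ℝ) (t (i + 1)))).toReal * D * δ :=
            mul_le_mul_of_nonneg_left (hmesh i hi).le (mul_nonneg hV0 hD0)
        _ = _ := by ring
    have hVsum : ∑ i ∈ Finset.range n, (eVariationOn f (Set.Icc (t i : ℝ) (t (i + 1)))).toReal
        = V := by
      have h := eVariationOn.sum' f (I := fun i => (t i : ℝ)) (fun i j h => hm h) (n := n)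
      simp only [h0, hn] at h
      rw [← ENNReal.toReal_sum fun i _ => hf.mono (hsub i)]
      exact congrArg _ h
    rw [hint]
    change |∑ i ∈ Finset.range n, f (ξ i) * (p.eval (t (i + 1) : ℝ) - p.eval (t i : ℝ)) - _| ≤ _
    rw [← Finset.sum_sub_distrib, ← hVsum, Finset.mul_sum]
    exact (Finset.abs_sum_le_sum_abs _ _).trans (Finset.sum_le_sum hbound)
  rw [(meshFilter_hasBasis a b).tendsto_iff Metric.nhds_basis_ball]
  intro ε hε
  have hV : 0 ≤ V := ENNReal.toReal_nonneg
  refine ⟨ε / (D * V + 1), by positivity, fun P hP => ?_⟩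
  rw [Metric.mem_ball, Real.dist_eq]
  refine (key _ (by positivity) P hP).trans_lt ?_
  rw [mul_div_assoc', div_mul_eq_mul_div, div_lt_iff₀ (by positivity)]
  nlinarith [mul_nonneg hD0 hV]

lemma rsSum_sub_right {a b : ℝ} (f : ℝ → ℝ) (g h : Set.Icc a b → ℝ)
    (P : ℕ × (ℕ → Set.Icc a b) × (ℕ → Set.Icc a b)) :
    rsSum f (fun t => g t - h t) P = rsSum f g P - rsSum f h P := by
  simp only [rsSum]
  rw [← Finset.sum_sub_distrib]
  exact Finset.sum_congr rfl fun i _ => by ring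

/-- A function of bounded variation is Riemann–Stieltjes integrable against a continuous one. -/
lemma exists_hasRSIntegral {a b : ℝ} (hab : a ≤ b) {f : ℝ → ℝ}
    (hf : BoundedVariationOn f (Set.Icc a b)) {g : Set.Icc a b → ℝ} (hg : Continuous g) :
    ∃ c, HasRSIntegral a b f g c := by
  have := meshFilter_neBot hab
  simp only [hasRSIntegral_iff_tendsto]
  refine cauchy_map_iff_exists_tendsto.1 (Metric.cauchy_iff.2 ⟨inferInstance, fun ε hε => ?_⟩)
  set C := 2 * |f a| + 3 * (eVariationOn f (Set.Icc a b)).toReal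
  have hC : 0 ≤ C := by positivity
  -- Weierstrass approximation: by `abs_rsSum_le`, replacing g by p changes a sum by at most C ε /
  -- (4(C + 1)) ≤ ε / 4. Two such changes and two deviations from the limit for p, each below ε / 4,
  -- give the Cauchy property.
  obtain ⟨p, hp⟩ := exists_polynomial_near_of_continuousOn a b (Set.IccExtend hab g)
    hg.Icc_extend'.continuousOn (ε / (4 * (C + 1))) (by positivity)
  have hclose : ∀ᶠ P in meshFilter a b,
      |rsSum f g P - rsSum f (fun t => p.eval (t : ℝ)) P| ≤ ε / 4 := by
    filter_upwards [(meshFilter_hasBasis a b).mem_of_mem one_pos] with P hP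
    rw [← rsSum_sub_right]
    refine (abs_rsSum_le hf (M := ε / (4 * (C + 1))) (fun t => ?_) hP).trans ?_
    · have := hp t t.2
      rw [Set.IccExtend_val, abs_sub_comm] at this
      exact this.le
    · rw [mul_div_assoc', div_le_div_iff₀ (by positivity) (by positivity)]
      nlinarith
  have hlim := (Metric.tendsto_nhds.1 (tendsto_rsSum_polynomial hab hf p)) (ε / 4) (by positivity)
  refine ⟨_, image_mem_map (hclose.and hlim), ?_⟩
  rintro _ ⟨P, ⟨h1, h2⟩, rfl⟩ _ ⟨Q, ⟨h3, h4⟩, rfl⟩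
  rw [Real.dist_eq] at h2 h4 ⊢
  rw [abs_le] at h1 h3
  rw [abs_lt] at h2 h4 ⊢
  constructor <;> linarith [h1.1, h1.2, h2.1, h2.2, h3.1, h3.2, h4.1, h4.2]

lemma tendsto_rsSum_rsIntegral {a b : ℝ} (hab : a ≤ b) {f : ℝ → ℝ}
    (hf : BoundedVariationOn f (Set.Icc a b)) {g : Set.Icc a b → ℝ} (hg : Continuous g) :
    Tendsto (rsSum f g) (meshFilter a b) (𝓝 (rsIntegral a b f g)) := by
  obtain ⟨c, hc⟩ := exists_hasRSIntegral hab hf hg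
  rw [hc.rsIntegral_eq hab]
  exact hasRSIntegral_iff_tendsto.1 hc

/-- The Riemann–Stieltjes integral is linear in the integrator. -/
lemma rsIntegral_linear_right {a b : ℝ} (hab : a ≤ b) {f : ℝ → ℝ}
    (hf : BoundedVariationOn f (Set.Icc a b)) {g h : Set.Icc a b → ℝ} (hg : Continuous g)
    (hh : Continuous h) (c d : ℝ) :
    rsIntegral a b f (fun t => c * g t + d * h t) =
      c * rsIntegral a b f g + d * rsIntegral a b f h := by
  refine HasRSIntegral.rsIntegral_eq hab (hasRSIntegral_iff_tendsto.2 ?_)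
  refine (((tendsto_rsSum_rsIntegral hab hf hg).const_mul c).add
    ((tendsto_rsSum_rsIntegral hab hf hh).const_mul d)).congr fun P => ?_
  simp only [rsSum, Finset.mul_sum, ← Finset.sum_add_distrib]
  exact Finset.sum_congr rfl fun i _ => by ring

/-- The Riemann–Stieltjes integral is linear in the integrand. -/
lemma rsIntegral_sum_left {a b : ℝ} (hab : a ≤ b) {f : ℕ → ℝ → ℝ}
    (hf : ∀ k, BoundedVariationOn (f k) (Set.Icc a b)) {g : Set.Icc a b → ℝ} (hg : Continuous g)
    (c : ℕ → ℝ) (N : ℕ) :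
    rsIntegral a b (fun t => ∑ k ∈ Finset.range N, c k * f k t) g =
      ∑ k ∈ Finset.range N, c k * rsIntegral a b (f k) g := by
  refine HasRSIntegral.rsIntegral_eq hab (hasRSIntegral_iff_tendsto.2 ?_)
  refine (tendsto_finsetSum _ fun k _ =>
    (tendsto_rsSum_rsIntegral hab (hf k) hg).const_mul (c k)).congr fun P => ?_
  simp only [rsSum, Finset.mul_sum, Finset.sum_mul]
  rw [Finset.sum_comm]
  exact Finset.sum_congr rfl fun i _ => Finset.sum_congr rfl fun k _ => by ring

/-! ### Limits, independence and series of Gaussian variables -/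

section GaussianSequences

open Complex in
/-- An almost everywhere limit of centred Gaussian variables with convergent variances is
Gaussian. -/
lemma map_eq_gaussianReal_of_ae_tendsto {Ω : Type*} {mΩ : MeasurableSpace Ω} {μ : Measure Ω}
    [IsProbabilityMeasure μ] {S : ℕ → Ω → ℝ} {X : Ω → ℝ} {v : ℕ → NNReal} {w : NNReal}
    (hS : ∀ k, AEMeasurable (S k) μ) (hlaw : ∀ k, μ.map (S k) = gaussianReal 0 (v k))
    (hlim : ∀ᵐ ω ∂μ, Tendsto (fun k => S k ω) atTop (𝓝 (X ω)))
    (hv : Tendsto (fun k => (v k : ℝ)) atTop (𝓝 (w : ℝ))) :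
    AEMeasurable X μ ∧ μ.map X = gaussianReal 0 w := by
  have hX : AEMeasurable X μ := aemeasurable_of_tendsto_metrizable_ae atTop hS hlim
  refine ⟨hX, ?_⟩
  have := Measure.isProbabilityMeasure_map hX
  refine Measure.ext_of_charFun (funext fun t => ?_)
  have hchar : ∀ {Y : Ω → ℝ}, AEMeasurable Y μ →
      charFun (μ.map Y) t = ∫ ω, cexp (t * Y ω * I) ∂μ := by
    intro Y hY
    rw [charFun_apply_real, integral_map hY (by fun_prop)]
  -- The characteristic functions of the S k have two limits: that of X by dominated convergence,
  -- and the Gaussian one by continuity in the variance, w = 0 included.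
  have h1 : Tendsto (fun k => ∫ ω, cexp (t * S k ω * I) ∂μ) atTop
      (𝓝 (∫ ω, cexp (t * X ω * I) ∂μ)) := by
    refine tendsto_integral_of_dominated_convergence (fun _ => 1) (fun k => ?_)
      (integrable_const _) (fun k => ?_) ?_
    · have := hS k
      exact AEMeasurable.aestronglyMeasurable (by fun_prop)
    · refine Eventually.of_forall fun ω => ?_
      rw [← ofReal_mul, norm_exp_ofReal_mul_I]
    · filter_upwards [hlim] with ω hω
      have hc : Continuous fun x : ℝ => cexp (t * x * I) := by fun_prop
      exact (hc.tendsto _).comp hω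
  have h2 : Tendsto (fun k => charFun (gaussianReal 0 (v k)) t) atTop
      (𝓝 (charFun (gaussianReal 0 w) t)) := by
    simp only [charFun_gaussianReal]
    have hc : Continuous fun x : ℝ => cexp (t * (0 : ℝ) * I - x * t ^ 2 / 2) := by fun_prop
    exact (hc.tendsto _).comp hv
  rw [hchar hX]
  refine tendsto_nhds_unique h1 (h2.congr fun k => ?_)
  rw [← hlaw, hchar (hS k)]

/-- The family `X` is standard Gaussian: every linear combination is a centred Gaussian variable
with variance the sum of the squares of the coefficients. -/
def IsStdGaussianFamily {Ω ι : Type*} [Fintype ι] {mΩ : MeasurableSpace Ω} (X : ι → Ω → ℝ)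
    (μ : Measure Ω) : Prop :=
  ∀ c : ι → ℝ, μ.map (fun ω => ∑ i, c i * X i ω) = gaussianReal 0 (∑ i, (c i ^ 2).toNNReal)

lemma IsStdGaussianFamily.map_eq {Ω ι : Type*} [Fintype ι] {mΩ : MeasurableSpace Ω}
    {X : ι → Ω → ℝ} {μ : Measure Ω} (h : IsStdGaussianFamily X μ) (i : ι) :
    μ.map (X i) = gaussianReal 0 1 := by
  classical
  have := h (Pi.single i 1)
  have h1 : ∑ j, ((Pi.single i (1 : ℝ) : ι → ℝ) j ^ 2).toNNReal = 1 := by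
    rw [Finset.sum_eq_single i (fun j _ hj => by simp [hj]) (by simp)]
    simp
  rw [h1] at this
  simpa [Pi.single_apply] using this

-- The characteristic function of the vector at t is that of ∑ t_i X_i at 1, namely exp(-∑ t_i² /
-- 2), which is a product over the coordinates.
open Complex in
lemma IsStdGaussianFamily.iIndepFun {Ω ι : Type*} [Fintype ι] {mΩ : MeasurableSpace Ω}
    {X : ι → Ω → ℝ} {μ : Measure Ω} [IsProbabilityMeasure μ] (h : IsStdGaussianFamily X μ)
    (hX : ∀ i, AEMeasurable (X i) μ) : iIndepFun X μ := by
  rw [iIndepFun_iff_charFun_pi hX]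
  intro t
  have hm : AEMeasurable (fun ω => WithLp.toLp 2 (X · ω) : Ω → EuclideanSpace ℝ ι) μ := by fun_prop
  have hs : AEMeasurable (fun ω => ∑ i, t i * X i ω) μ := by fun_prop
  have h1 : charFun (μ.map fun ω => (WithLp.toLp 2 (X · ω) : EuclideanSpace ℝ ι)) t =
      charFun (μ.map fun ω => ∑ i, t i * X i ω) 1 := by
    rw [charFun_apply, charFun_apply_real, integral_map hm (by fun_prop),
      integral_map hs (by fun_prop)]
    refine integral_congr_ae (Eventually.of_forall fun ω => ?_)
    simp [PiLp.inner_apply]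
  rw [h1, h]
  simp only [h.map_eq, charFun_gaussianReal]
  rw [← Complex.exp_sum]
  congr 1
  simp [sq_nonneg, Finset.sum_div]

/-- The infinite version of `IsStdGaussianFamily.iIndepFun`. -/
lemma iIndepFun_of_isStdGaussianFamily_range {Ω : Type*} {mΩ : MeasurableSpace Ω} {Z : ℕ → Ω → ℝ}
    {μ : Measure Ω} [IsProbabilityMeasure μ] (hZ : ∀ k, AEMeasurable (Z k) μ)
    (h : ∀ (c : ℕ → ℝ) (N : ℕ), μ.map (fun ω => ∑ k ∈ Finset.range N, c k * Z k ω) =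
      gaussianReal 0 (∑ k ∈ Finset.range N, (c k ^ 2).toNNReal)) : iIndepFun Z μ := by
  classical
  rw [iIndepFun_iff_finset]
  intro s
  refine IsStdGaussianFamily.iIndepFun (fun c => ?_) fun i => hZ i
  set d : ℕ → ℝ := fun k => if hk : k ∈ s then c ⟨k, hk⟩ else 0 with hd
  obtain ⟨N, hN⟩ : ∃ N, s ⊆ Finset.range N :=
    ⟨s.sup id + 1, fun k hk => Finset.mem_range.2 (Nat.lt_succ_of_le (Finset.le_sup (f := id) hk))⟩
  have hdi : ∀ i : s, d i = c i := fun i => by simp [hd]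
  have hd0 : ∀ k, k ∉ s → d k = 0 := fun k hk => by simp [hd, hk]
  have h1 : ∀ ω, ∑ k ∈ Finset.range N, d k * Z k ω = ∑ i : s, c i * s.restrict Z i ω := by
    intro ω
    rw [← Finset.sum_subset hN fun k _ hk => by rw [hd0 k hk, zero_mul], ← Finset.sum_coe_sort s]
    exact Finset.sum_congr rfl fun i _ => by rw [hdi]; rfl
  have h2 : ∑ k ∈ Finset.range N, (d k ^ 2).toNNReal = ∑ i : s, (c i ^ 2).toNNReal := by
    rw [← Finset.sum_subset hN fun k _ hk => by simp [hd0 k hk], ← Finset.sum_coe_sort s]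
    exact Finset.sum_congr rfl fun i _ => by rw [hdi]
  simpa only [h1, h2] using h d N

lemma integral_sq_gaussianReal_zero (v : NNReal) : ∫ x, x ^ 2 ∂gaussianReal 0 v = v := by
  have h := variance_fun_id_gaussianReal (μ := 0) (v := v)
  rw [variance_eq_integral measurable_id'.aemeasurable] at h
  simpa using h

/-- A series of independent standard Gaussian variables with square summable coefficients converges
almost surely. -/
lemma ae_exists_tendsto_sum_of_gaussian {Ω : Type*} {mΩ : MeasurableSpace Ω} {Z : ℕ → Ω → ℝ}
    {μ : Measure Ω} [IsProbabilityMeasure μ] (hZ : ∀ k, Measurable (Z k))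
    (h : ∀ (c : ℕ → ℝ) (N : ℕ), μ.map (fun ω => ∑ k ∈ Finset.range N, c k * Z k ω) =
      gaussianReal 0 (∑ k ∈ Finset.range N, (c k ^ 2).toNNReal))
    {a : ℕ → ℝ} (ha : Summable fun k => a k ^ 2) :
    ∀ᵐ ω ∂μ, ∃ c, Tendsto (fun N => ∑ k ∈ Finset.range N, a k * Z k ω) atTop (𝓝 c) := by
  have hZi := iIndepFun_of_isStdGaussianFamily_range (fun k => (hZ k).aemeasurable) h
  set S : ℕ → Ω → ℝ := fun N ω => ∑ k ∈ Finset.range N, a k * Z k ω with hS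
  have hSm : ∀ N, Measurable (S N) := fun N => by fun_prop
  have hL2 : ∀ N, MemLp (S N) 2 μ := by
    intro N
    have := memLp_id_gaussianReal' (μ := 0) (v := ∑ k ∈ Finset.range N, (a k ^ 2).toNNReal) 2
      (by norm_num)
    rw [← h a N, memLp_map_measure_iff aestronglyMeasurable_id (hSm N).aemeasurable] at this
    exact this
  have hZlaw : ∀ k, μ.map (Z k) = gaussianReal 0 1 := by
    intro k
    have := h (Pi.single k 1) (k + 1)
    rw [Finset.sum_eq_single_of_mem k (by simp) (fun j _ hj => by simp [hj])] at this
    have h2 : ∀ ω, ∑ j ∈ Finset.range (k + 1), (Pi.single k (1 : ℝ) : ℕ → ℝ) j * Z j ω = Z k ω := by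
      intro ω
      rw [Finset.sum_eq_single_of_mem k (by simp) (fun j _ hj => by simp [hj])]
      simp
    simpa [h2] using this
  have hZint : ∀ k, ∫ ω, Z k ω ∂μ = 0 := by
    intro k
    rw [← integral_map (f := fun x => x) (hZ k).aemeasurable aestronglyMeasurable_id, hZlaw,
      integral_id_gaussianReal]
  have hZsm : ∀ k, StronglyMeasurable (Z k) := fun k => (hZ k).stronglyMeasurable
  set ℱ := Filtration.natural Z hZsm
  -- The shift by one is needed for adaptedness: the natural filtration at time N contains Z_0, …,
  -- Z_N, which are the terms of S (N + 1).
  have hmart : Martingale (fun N => S (N + 1)) ℱ μ := by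
    refine martingale_of_condExp_sub_eq_zero_nat (fun N => ?_)
      (fun N => (hL2 _).integrable (by norm_num)) fun N => ?_
    · refine Measurable.stronglyMeasurable ?_
      refine Finset.measurable_fun_sum _ fun k hk => Measurable.const_mul ?_ _
      exact ((Filtration.stronglyAdapted_natural hZsm k).measurable).mono
        (ℱ.mono (Nat.lt_succ_iff.1 (Finset.mem_range.1 hk))) le_rfl
    · have h1 : S (N + 1 + 1) - S (N + 1) = a (N + 1) • Z (N + 1) := by
        ext ω
        simp [hS, Finset.sum_range_succ _ (N + 1)]
      simp only [h1]
      refine (condExp_smul (a (N + 1)) (Z (N + 1)) (ℱ N)).trans ?_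
      filter_upwards [iIndepFun.condExp_natural_ae_eq_of_lt hZsm hZi N.lt_succ_self] with ω hω
      rw [Pi.smul_apply]
      erw [hω]
      simp [hZint]
  -- The L¹ norm is at most the L² norm, whose square is the variance ∑ a_k² over k ≤ N; this is the
  -- boundedness that martingale convergence asks for.
  have hbdd : ∀ N, eLpNorm (S (N + 1)) 1 μ ≤ (Real.toNNReal √(∑' k, a k ^ 2) : NNReal) := by
    intro N
    refine (eLpNorm_le_eLpNorm_of_exponent_le (p := 1) (q := 2) (by norm_num)
      (hSm _).aestronglyMeasurable).trans ?_
    rw [(hL2 _).eLpNorm_eq_integral_rpow_norm (by norm_num) (by norm_num)]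
    refine ENNReal.ofReal_le_ofReal ?_
    have h3 : ∫ ω, S (N + 1) ω ^ 2 ∂μ = ∑ k ∈ Finset.range (N + 1), a k ^ 2 := by
      rw [← integral_map (f := fun x => x ^ 2) (hSm _).aemeasurable (by fun_prop), h a (N + 1),
        integral_sq_gaussianReal_zero]
      simp [sq_nonneg]
    simp only [ENNReal.toReal_ofNat, Real.rpow_ofNat, Real.norm_eq_abs, sq_abs]
    rw [h3, ← one_div, ← Real.sqrt_eq_rpow]
    exact Real.sqrt_le_sqrt (ha.sum_le_tsum _ fun k _ => sq_nonneg _)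
  filter_upwards [hmart.submartingale.exists_ae_tendsto_of_bdd hbdd] with ω hω
  obtain ⟨c, hc⟩ := hω
  exact ⟨c, (tendsto_add_atTop_iff_nat 1).1 hc⟩

end GaussianSequences

/-! ### Moments of the standard Gaussian -/

section GaussianMoments

lemma integrable_pow_gaussianReal (k : ℕ) : Integrable (fun x => x ^ k) (gaussianReal 0 1) := by
  have h := memLp_id_gaussianReal' (μ := 0) (v := 1) k (by simp)
  have := h.integrable_norm_pow'
  rw [← integrable_norm_iff (by fun_prop)]
  simpa using this

lemma integral_odd_pow_gaussianReal (s : ℕ) : ∫ x, x ^ (2 * s + 1) ∂gaussianReal 0 1 = 0 := by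
  have h : (gaussianReal 0 1).map (fun x => -x) = gaussianReal 0 1 := by
    rw [gaussianReal_map_neg]; simp
  have h1 : ∫ x, x ^ (2 * s + 1) ∂gaussianReal 0 1 = ∫ x, (-x) ^ (2 * s + 1) ∂gaussianReal 0 1 := by
    conv_lhs => rw [← h]
    rw [integral_map (by fun_prop) (by fun_prop)]
  rw [funext fun x : ℝ => (Odd.neg_pow (n := 2 * s + 1) ⟨s, rfl⟩ x), integral_neg] at h1
  linarith

/-- Folding onto the half-line gives a Gamma integral, and Γ(s + 1/2) = (2s-1)!! √π / 2^s. At s = 0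
truncated subtraction gives 0!! = 1, in agreement with (-1)!! = 1. -/
lemma integral_even_pow_gaussianReal (s : ℕ) :
    ∫ x, x ^ (2 * s) ∂gaussianReal 0 1 = Nat.doubleFactorial (2 * s - 1) := by
  rw [integral_gaussianReal_eq_integral_smul one_ne_zero]
  have h1 : ∀ x : ℝ, gaussianPDFReal 0 1 x • x ^ (2 * s) =
      (√(2 * Real.pi))⁻¹ * (|x| ^ (2 * s : ℝ) * Real.exp (-(1 / 2) * |x| ^ (2 : ℝ))) := by
    intro x
    have : |x| ^ (2 * s : ℝ) = x ^ (2 * s) := by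
      rw [← Nat.cast_ofNat, ← Nat.cast_mul, Real.rpow_natCast, pow_mul, sq_abs, ← pow_mul]
    rw [this, Real.rpow_two, sq_abs, gaussianPDFReal, smul_eq_mul, NNReal.coe_one, mul_one, sub_zero,
      neg_mul, neg_div, one_div_mul_eq_div]
    ring
  simp only [h1]
  rw [integral_const_mul, integral_comp_abs (f := fun x =>
    x ^ (2 * s : ℝ) * Real.exp (-(1 / 2) * x ^ (2 : ℝ))),
    integral_rpow_mul_exp_neg_mul_rpow two_pos (by linarith [s.cast_nonneg (α := ℝ)]) (by norm_num)]
  have h2 : (2 * (s : ℝ) + 1) / 2 = s + 1 / 2 := by ring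
  have h3 : (1 / 2 : ℝ) ^ (-(2 * (s : ℝ) + 1) / 2) = 2 ^ s * √2 := by
    rw [neg_div, h2, one_div, Real.inv_rpow zero_le_two, Real.rpow_neg zero_le_two, inv_inv,
      Real.rpow_add two_pos, Real.rpow_natCast, Real.sqrt_eq_rpow, one_div]
  rw [h2, h3, Real.Gamma_nat_add_half, Real.sqrt_mul zero_le_two]
  have := Real.sqrt_pos.2 Real.pi_pos
  field_simp

/-- Separates parities in the binomial expansion, so that the odd moments drop out. -/
lemma sum_range_two_mul_add_one (f : ℕ → ℝ) (p : ℕ) :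
    ∑ k ∈ Finset.range (2 * p + 1), f k =
      ∑ s ∈ Finset.range (p + 1), f (2 * s) + ∑ s ∈ Finset.range p, f (2 * s + 1) := by
  induction p with
  | zero => simp
  | succ p ih =>
    rw [show 2 * (p + 1) + 1 = 2 * p + 1 + 1 + 1 by ring, Finset.sum_range_succ,
      Finset.sum_range_succ, ih, Finset.sum_range_succ _ (p + 1),
      Finset.sum_range_succ (fun s => f (2 * s + 1)) p, show 2 * (p + 1) = 2 * p + 1 + 1 by ring]
    ring_nf

/-- The even moments of an affine image of a standard Gaussian variable. -/
lemma integral_affine_pow_gaussianReal (p : ℕ) (γ d : ℝ) :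
    Integrable (fun x => (γ * x + d) ^ (2 * p)) (gaussianReal 0 1) ∧
    ∫ x, (γ * x + d) ^ (2 * p) ∂gaussianReal 0 1 =
      ∑ s ∈ Finset.range (p + 1), ((2 * p).choose (2 * s) : ℝ) *
        (Nat.doubleFactorial (2 * s - 1) : ℝ) * γ ^ (2 * s) * d ^ (2 * p - 2 * s) := by
  have h1 : ∀ x : ℝ, (γ * x + d) ^ (2 * p) = ∑ k ∈ Finset.range (2 * p + 1),
      (γ ^ k * d ^ (2 * p - k) * ((2 * p).choose k : ℝ)) * x ^ k := by
    intro x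
    rw [add_pow]
    exact Finset.sum_congr rfl fun k _ => by rw [mul_pow]; ring
  have hint : ∀ k ∈ Finset.range (2 * p + 1), Integrable
      (fun x => (γ ^ k * d ^ (2 * p - k) * ((2 * p).choose k : ℝ)) * x ^ k) (gaussianReal 0 1) :=
    fun k _ => (integrable_pow_gaussianReal k).const_mul _
  simp only [h1]
  refine ⟨integrable_finsetSum _ hint, ?_⟩
  rw [integral_finsetSum _ hint]
  simp only [integral_const_mul]
  rw [sum_range_two_mul_add_one]
  simp only [integral_odd_pow_gaussianReal, integral_even_pow_gaussianReal, mul_zero,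
    Finset.sum_const_zero, add_zero]
  exact Finset.sum_congr rfl fun s _ => by ring

end GaussianMoments

/-! ### The Wiener integral of a function of bounded variation -/

/-- Along a monotone sequence min (t a) (t b) = t (min a b), so the four covariances cancel unless i
= j. -/
lemma covariance_increments {T : ℝ} {m : Measure (WienerSpace T)} (hm : IsWienerMeasure m)
    {t : ℕ → Set.Icc (0 : ℝ) T} (ht : Monotone t) (i j : ℕ) :
    covariance (fun x : WienerSpace T => x.1 (t (i + 1)) - x.1 (t i))
      (fun x : WienerSpace T => x.1 (t (j + 1)) - x.1 (t j)) m =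
      if i = j then (t (i + 1) : ℝ) - t i else 0 := by
  have := hm.isProbabilityMeasure
  have hL : ∀ s, MemLp (fun x : WienerSpace T => x.1 s) 2 m := fun s =>
    (hm.isGaussianProcess.hasGaussianLaw_eval s).memLp_two
  rw [covariance_fun_sub_fun_sub (hL _) (hL _) (hL _) (hL _)]
  simp only [hm.covariance_eq]
  have ht' : Monotone fun i => (t i : ℝ) := fun i j h => ht h
  have hmin : ∀ a b : ℕ, min (t a : ℝ) (t b) = t (min a b) := fun a b =>
    (ht'.map_min (a := a) (b := b)).symm
  simp only [hmin]
  split_ifs with h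
  · subst h
    simp
  · rcases lt_or_gt_of_ne h with h | h
    · rw [min_eq_left (by omega), min_eq_left (by omega), min_eq_left (by omega),
        min_eq_left (by omega)]
      ring
    · rw [min_eq_right (by omega), min_eq_right (by omega), min_eq_right (by omega),
        min_eq_right (by omega)]
      ring

/-- Under Wiener measure a Riemann–Stieltjes sum is a centred Gaussian variable. -/
lemma map_rsSum_eq_gaussianReal {T : ℝ} {m : Measure (WienerSpace T)} (hm : IsWienerMeasure m)
    (f : ℝ → ℝ) (P : ℕ × (ℕ → Set.Icc (0 : ℝ) T) × (ℕ → Set.Icc (0 : ℝ) T)) (hP : Monotone P.2.1) :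
    m.map (fun x : WienerSpace T => rsSum f x.1 P) =
      gaussianReal 0 (rsSum (fun t => f t ^ 2) (fun t : Set.Icc (0 : ℝ) T => (t : ℝ)) P).toNNReal := by
  have := hm.isProbabilityMeasure
  obtain ⟨n, t, ξ⟩ := P
  change Monotone t at hP
  have hG : IsGaussianProcess (fun (i : ℕ) (x : WienerSpace T) =>
      f (ξ i) * (x.1 (t (i + 1)) - x.1 (t i))) m := by
    refine hm.isGaussianProcess.of_isGaussianProcess fun i => ?_
    classical
    refine ⟨{t (i + 1), t i}, f (ξ i) • (ContinuousLinearMap.proj ⟨t (i + 1), by simp⟩ -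
      ContinuousLinearMap.proj ⟨t i, by simp⟩), fun x => ?_⟩
    simp
  have hS : HasGaussianLaw (fun x : WienerSpace T => rsSum f x.1 (n, t, ξ)) m :=
    hG.hasGaussianLaw_fun_sum (I := Finset.range n)
  rw [hS.map_eq_gaussianReal]
  have hL : ∀ s, Integrable (fun x : WienerSpace T => x.1 s) m := fun s =>
    (hm.isGaussianProcess.hasGaussianLaw_eval s).integrable
  have hmean : ∫ x : WienerSpace T, rsSum f x.1 (n, t, ξ) ∂m = 0 := by
    simp only [rsSum]
    have hLi : ∀ i ∈ Finset.range n, Integrable (fun x : WienerSpace T =>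
        f (ξ i) * (x.1 (t (i + 1)) - x.1 (t i))) m := fun i _ =>
      ((hL _).sub (hL _)).const_mul _
    rw [integral_finsetSum _ hLi]
    refine Finset.sum_eq_zero fun i _ => ?_
    rw [integral_const_mul, integral_sub (hL _) (hL _), hm.mean_eq, hm.mean_eq]
    simp
  -- Since increments are uncorrelated, only the diagonal terms f(ξ_i)² (t_{i+1} - t_i) survive: the
  -- discrete form of the Wiener isometry.
  have hvar : variance (fun x : WienerSpace T => rsSum f x.1 (n, t, ξ)) m =
      rsSum (fun t => f t ^ 2) (fun t : Set.Icc (0 : ℝ) T => (t : ℝ)) (n, t, ξ) := by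
    rw [← covariance_self hS.aemeasurable]
    simp only [rsSum]
    have hLp : ∀ i ∈ Finset.range n, MemLp (fun x : WienerSpace T =>
        f (ξ i) * (x.1 (t (i + 1)) - x.1 (t i))) 2 m := fun i _ =>
      (hG.hasGaussianLaw_eval i).memLp_two
    rw [covariance_fun_sum_fun_sum' hLp hLp]
    refine Finset.sum_congr rfl fun i hi => ?_
    simp only [covariance_const_mul_left, covariance_const_mul_right, covariance_increments hm hP]
    rw [Finset.sum_eq_single_of_mem i hi fun j _ hj => by simp [hj.symm]]
    simp
    ring
  rw [hmean, hvar]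

/-- The integrator is the polynomial X, with derivative 1. This is the limit of the variances of the
Riemann–Stieltjes sums. -/
lemma tendsto_rsSum_sq {T : ℝ} (hT : 0 ≤ T) {f : ℝ → ℝ}
    (hf : BoundedVariationOn f (Set.Icc 0 T)) :
    Tendsto (rsSum (fun t => f t ^ 2) fun t : Set.Icc (0 : ℝ) T => (t : ℝ)) (meshFilter 0 T)
      (𝓝 (∫ t in (0 : ℝ)..T, f t ^ 2)) := by
  have h : BoundedVariationOn (fun t => f t ^ 2) (Set.Icc 0 T) := by
    simpa only [pow_two] using! hf.fun_mul hf
  simpa using tendsto_rsSum_polynomial hT h Polynomial.X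

lemma continuous_wienerSpace_coe {T : ℝ} (x : WienerSpace T) :
    Continuous (x.1 : Set.Icc (0 : ℝ) T → ℝ) := x.1.continuous

lemma measurable_eval_wienerSpace {T : ℝ} (t : Set.Icc (0 : ℝ) T) :
    Measurable fun x : WienerSpace T => x.1 t := by
  have : Continuous fun x : WienerSpace T => x.1 t :=
    (continuous_eval_const t).comp continuous_subtype_val
  exact this.measurable

/-- Along the sequence of uniform partitions the integral is a pointwise limit of finite
combinations of coordinates. -/
lemma measurable_rsIntegral {T : ℝ} (hT : 0 ≤ T) {f : ℝ → ℝ}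
    (hf : BoundedVariationOn f (Set.Icc 0 T)) :
    Measurable fun x : WienerSpace T => rsIntegral 0 T f x.1 := by
  refine measurable_of_tendsto_metrizable (f := fun k (x : WienerSpace T) =>
    rsSum f x.1 (uniformPartition hT k)) (fun k => ?_) (tendsto_pi_nhds.2 fun x => ?_)
  · exact Finset.measurable_fun_sum _ fun i _ =>
      ((measurable_eval_wienerSpace _).sub (measurable_eval_wienerSpace _)).const_mul _
  · exact (tendsto_rsSum_rsIntegral hT hf (continuous_wienerSpace_coe x)).comp
      (tendsto_uniformPartition hT)

/-- The Wiener integral of a function of bounded variation is a centred Gaussian variable. -/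
lemma map_rsIntegral_eq_gaussianReal {T : ℝ} (hT : 0 ≤ T) {m : Measure (WienerSpace T)}
    (hm : IsWienerMeasure m) {f : ℝ → ℝ} (hf : BoundedVariationOn f (Set.Icc 0 T)) :
    m.map (fun x : WienerSpace T => rsIntegral 0 T f x.1) =
      gaussianReal 0 (∫ t in (0 : ℝ)..T, f t ^ 2).toNNReal := by
  have := hm.isProbabilityMeasure
  have hU := tendsto_uniformPartition hT
  refine (map_eq_gaussianReal_of_ae_tendsto
    (S := fun k (x : WienerSpace T) => rsSum f x.1 (uniformPartition hT k)) (fun k => ?_)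
    (fun k => map_rsSum_eq_gaussianReal hm f _ (uniformPartition_monotone hT k))
    (Eventually.of_forall fun x =>
      (tendsto_rsSum_rsIntegral hT hf (continuous_wienerSpace_coe x)).comp hU) ?_).2
  · exact (Finset.measurable_fun_sum _ fun i _ => ((measurable_eval_wienerSpace _).sub
      (measurable_eval_wienerSpace _)).const_mul _).aemeasurable
  · have h := (continuous_real_toNNReal.tendsto _).comp ((tendsto_rsSum_sq hT hf).comp hU)
    exact (NNReal.continuous_coe.tendsto _).comp h

lemma BoundedVariationOn.add_real {f g : ℝ → ℝ} {s : Set ℝ} (hf : BoundedVariationOn f s)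
    (hg : BoundedVariationOn g s) : BoundedVariationOn (fun x => f x + g x) s := by
  have h : eVariationOn (fun x => f x + g x) s ≤ eVariationOn f s + eVariationOn g s := by
    refine iSup_le fun ⟨n, u, hu, us⟩ => ?_
    calc ∑ i ∈ Finset.range n, edist (f (u (i + 1)) + g (u (i + 1))) (f (u i) + g (u i))
        ≤ ∑ i ∈ Finset.range n, (edist (f (u (i + 1))) (f (u i)) +
            edist (g (u (i + 1))) (g (u i))) :=
          Finset.sum_le_sum fun i _ => edist_add_add_le _ _ _ _
      _ ≤ eVariationOn f s + eVariationOn g s := by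
          rw [Finset.sum_add_distrib]
          exact add_le_add (eVariationOn.sum_le hu us) (eVariationOn.sum_le hu us)
  exact ((h.trans_lt (ENNReal.add_lt_top.2 ⟨hf.lt_top, hg.lt_top⟩))).ne

lemma boundedVariationOn_sum_mul {f : ℕ → ℝ → ℝ} {s : Set ℝ}
    (hf : ∀ k, BoundedVariationOn (f k) s) (c : ℕ → ℝ) (N : ℕ) :
    BoundedVariationOn (fun t => ∑ k ∈ Finset.range N, c k * f k t) s := by
  have hc : ∀ a : ℝ, BoundedVariationOn (fun _ : ℝ => a) s := fun a =>
    (eVariationOn.constant_on (Set.subsingleton_singleton.anti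
      (Set.image_subset_iff.2 fun _ _ => rfl : (fun _ : ℝ => a) '' s ⊆ {a}))).trans_ne
      ENNReal.zero_ne_top
  induction N with
  | zero => simpa using hc 0
  | succ N ih =>
    simp only [Finset.sum_range_succ]
    exact ih.add_real ((hc (c N)).fun_mul (hf N))

/-! ### The Paley–Wiener–Zygmund integral as a Gaussian series -/

/-- The Parseval identity for finite combinations of the functions representing an orthonormal
basis. -/
lemma integral_sq_sum_fn {T : ℝ} (hT : 0 ≤ T) (φ : BVOrthonormalBasis T) (c : ℕ → ℝ) (N : ℕ) :
    ∫ t in (0 : ℝ)..T, (∑ k ∈ Finset.range N, c k * φ.fn k t) ^ 2 =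
      ∑ k ∈ Finset.range N, c k ^ 2 := by
  set w : L2Space T := ∑ k ∈ Finset.range N, c k • φ.basis k with hw
  have h1 : inner ℝ w w = ∑ k ∈ Finset.range N, c k ^ 2 := by
    rw [hw, φ.basis.orthonormal.inner_sum]
    simp [pow_two]
  have h2 : (w : ℝ → ℝ) =ᵐ[volume.restrict (Set.Icc (0 : ℝ) T)]
      fun t => ∑ k ∈ Finset.range N, c k * φ.fn k t := by
    have h3 : ∀ᵐ t ∂volume.restrict (Set.Icc (0 : ℝ) T), ∀ k, (c k • φ.basis k : L2Space T) t =
        c k * φ.fn k t := by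
      refine ae_all_iff.2 fun k => ?_
      filter_upwards [Lp.coeFn_smul (c k) (φ.basis k), φ.ae_eq k] with t ht ht'
      rw [ht, Pi.smul_apply, ht', smul_eq_mul]
    filter_upwards [Lp.coeFn_finsetSum (Finset.range N) fun k => c k • φ.basis k, h3] with t ht ht'
    rw [hw, ht, Finset.sum_apply]
    exact Finset.sum_congr rfl fun k _ => ht' k
  rw [← h1, L2.inner_def, intervalIntegral.integral_of_le hT, ← integral_Icc_eq_integral_Ioc]
  refine integral_congr_ae ?_
  filter_upwards [h2] with t ht
  simp [ht, pow_two]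

/-- The Wiener integrals of the functions representing an orthonormal basis form a sequence of
independent standard Gaussian variables. -/
lemma map_sum_rsIntegral_eq_gaussianReal {T : ℝ} (hT : 0 ≤ T) {m : Measure (WienerSpace T)}
    (hm : IsWienerMeasure m) (φ : BVOrthonormalBasis T) (c : ℕ → ℝ) (N : ℕ) :
    m.map (fun x : WienerSpace T => ∑ k ∈ Finset.range N, c k * rsIntegral 0 T (φ.fn k) x.1) =
      gaussianReal 0 (∑ k ∈ Finset.range N, (c k ^ 2).toNNReal) := by
  have h := map_rsIntegral_eq_gaussianReal hT hm
    (boundedVariationOn_sum_mul φ.boundedVariationOn c N)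
  rw [integral_sq_sum_fn hT, Real.toNNReal_sum_of_nonneg fun k _ => sq_nonneg _] at h
  rw [← h]
  congr 1
  funext x
  exact (rsIntegral_sum_left hT φ.boundedVariationOn (continuous_wienerSpace_coe x) c N).symm

/-- Only the coefficients depend on v; the random variables are the same Gaussian sequence for all
v. -/
lemma pwzApprox_eq_sum {T : ℝ} (hT : 0 ≤ T) (φ : BVOrthonormalBasis T) (v : L2Space T)
    (x : WienerSpace T) (N : ℕ) :
    pwzApprox φ v x N =
      ∑ k ∈ Finset.range N, inner ℝ v (φ.basis k) * rsIntegral 0 T (φ.fn k) x.1 :=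
  rsIntegral_sum_left hT φ.boundedVariationOn (continuous_wienerSpace_coe x) _ N

lemma pwzApprox_linear {T : ℝ} (hT : 0 ≤ T) (φ : BVOrthonormalBasis T) (v : L2Space T)
    (x y : WienerSpace T) (γ β : ℝ) (N : ℕ) :
    pwzApprox φ v (γ • x + β • y) N = γ * pwzApprox φ v x N + β * pwzApprox φ v y N :=
  rsIntegral_linear_right hT (boundedVariationOn_sum_mul φ.boundedVariationOn _ N)
    (continuous_wienerSpace_coe x) (continuous_wienerSpace_coe y) γ β

lemma PWZExists.tendsto {T : ℝ} {φ : BVOrthonormalBasis T} {v : L2Space T} {x : WienerSpace T}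
    (h : PWZExists φ v x) : Tendsto (pwzApprox φ v x) atTop (𝓝 (pwz φ v x)) :=
  tendsto_nhds_limUnder h

/-- Linearity holds for every pair of paths, with no exceptional null set, so one path may be a
fixed y. -/
lemma PWZExists.tendsto_linear {T : ℝ} (hT : 0 ≤ T) {φ : BVOrthonormalBasis T} {v : L2Space T}
    {x y : WienerSpace T} (hx : PWZExists φ v x) (hy : PWZExists φ v y) (γ β : ℝ) :
    Tendsto (pwzApprox φ v (γ • x + β • y)) atTop (𝓝 (γ * pwz φ v x + β * pwz φ v y)) :=
  ((hx.tendsto.const_mul γ).add (hy.tendsto.const_mul β)).congr fun N =>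
    (pwzApprox_linear hT φ v x y γ β N).symm

lemma hasSum_sq_inner_basis {T : ℝ} (φ : BVOrthonormalBasis T) (v : L2Space T) :
    HasSum (fun k => inner ℝ v (φ.basis k) ^ 2) (inner ℝ v v) := by
  have h := φ.basis.hasSum_inner_mul_inner v v
  simp only [real_inner_comm v, ← pow_two] at h
  simpa only [real_inner_comm v] using h

/-- The Paley–Wiener–Zygmund integral exists for almost every path. -/
lemma ae_pwzExists {T : ℝ} (hT : 0 ≤ T) {m : Measure (WienerSpace T)} (hm : IsWienerMeasure m)
    (φ : BVOrthonormalBasis T) (v : L2Space T) : ∀ᵐ x ∂m, PWZExists φ v x := by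
  have := hm.isProbabilityMeasure
  filter_upwards [ae_exists_tendsto_sum_of_gaussian
    (fun k => measurable_rsIntegral hT (φ.boundedVariationOn k))
    (map_sum_rsIntegral_eq_gaussianReal hT hm φ) (hasSum_sq_inner_basis φ v).summable] with x hx
  obtain ⟨c, hc⟩ := hx
  exact ⟨c, hc.congr fun N => (pwzApprox_eq_sum hT φ v x N).symm⟩

lemma measurable_pwzApprox {T : ℝ} (hT : 0 ≤ T) (φ : BVOrthonormalBasis T) (v : L2Space T)
    (N : ℕ) : Measurable fun x => pwzApprox φ v x N :=
  measurable_rsIntegral hT (boundedVariationOn_sum_mul φ.boundedVariationOn _ N)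

/-- The Paley–Wiener–Zygmund integrals of an orthonormal family form a standard Gaussian family. -/
lemma isStdGaussianFamily_pwz {T : ℝ} (hT : 0 ≤ T) {m : Measure (WienerSpace T)}
    (hm : IsWienerMeasure m) (φ : BVOrthonormalBasis T) {n : ℕ} {α : Fin n → L2Space T}
    (hα : Orthonormal ℝ α) : IsStdGaussianFamily (fun j x => pwz φ (α j) x) m := by
  have := hm.isProbabilityMeasure
  intro c
  -- By linearity in v, the combination of the approximations for the α_j is the partial sum of the
  -- series for w; the variances tend to ‖w‖² = ∑ c_j² by Parseval and orthonormality.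
  set w : L2Space T := ∑ j, c j • α j with hw
  have hSw : ∀ N (x : WienerSpace T), ∑ j, c j * pwzApprox φ (α j) x N =
      ∑ k ∈ Finset.range N, inner ℝ w (φ.basis k) * rsIntegral 0 T (φ.fn k) x.1 := by
    intro N x
    simp only [pwzApprox_eq_sum hT, hw, sum_inner, inner_smul_left, Finset.mul_sum, Finset.sum_mul]
    rw [Finset.sum_comm]
    exact Finset.sum_congr rfl fun k _ => Finset.sum_congr rfl fun j _ => by rw [conj_trivial]; ring
  have hww : inner ℝ w w = ∑ j, c j ^ 2 := by
    rw [hw, hα.inner_sum]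
    simp [pow_two]
  have hae : ∀ᵐ x ∂m, ∀ j, PWZExists φ (α j) x := ae_all_iff.2 fun j => ae_pwzExists hT hm φ (α j)
  refine (map_eq_gaussianReal_of_ae_tendsto
    (S := fun N (x : WienerSpace T) => ∑ j, c j * pwzApprox φ (α j) x N)
    (v := fun N => ∑ k ∈ Finset.range N, (inner ℝ w (φ.basis k) ^ 2).toNNReal)
    (fun N => ?_) (fun N => ?_) ?_ ?_).2
  · exact (Finset.measurable_fun_sum _ fun j _ =>
      (measurable_pwzApprox hT φ (α j) N).const_mul _).aemeasurable
  · simp only [hSw]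
    exact map_sum_rsIntegral_eq_gaussianReal hT hm φ _ N
  · filter_upwards [hae] with x hx
    exact tendsto_finsetSum _ fun j _ => (hx j).tendsto.const_mul (c j)
  · have h := (hasSum_sq_inner_basis φ w).tendsto_sum_nat
    rw [hww] at h
    simpa [sq_nonneg] using h

/-! ### The moment formula -/

theorem theorem1 (T : ℝ) (hT : 0 < T)
    (m : Measure (WienerSpace T)) (hm : IsWienerMeasure m)
    (φ : BVOrthonormalBasis T)
    (n : ℕ) (α : Fin n → L2Space T) (hα : Orthonormal ℝ α) (p : Fin n → ℕ)
    (γ β : ℝ) (hγ : γ ≠ 0) (hβ : β ≠ 0) :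
    HoldsScaleInvariantAE m (fun y => ∀ j, PWZExists φ (α j) y) ∧
    ∀ y : WienerSpace T, (∀ j, PWZExists φ (α j) y) →
      (∀ᵐ x ∂m, ∀ j, PWZExists φ (α j) (γ • x + β • y)) ∧
      Integrable (fun x => polyFunctional φ α p (γ • x + β • y)) m ∧
      ∫ x, polyFunctional φ α p (γ • x + β • y) ∂m =
        ∏ j, ∑ s ∈ Finset.range (p j + 1),
          ((2 * p j).choose (2 * s) : ℝ) * (Nat.doubleFactorial (2 * s - 1) : ℝ)
            * γ ^ (2 * s) * β ^ (2 * p j - 2 * s) * pwz φ (α j) y ^ (2 * p j - 2 * s) := by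
  have := hm.isProbabilityMeasure
  have hae : ∀ᵐ x ∂m, ∀ j, PWZExists φ (α j) x :=
    ae_all_iff.2 fun j => ae_pwzExists hT.le hm φ (α j)
  refine ⟨fun ρ _ => ?_, fun y hy => ?_⟩
  · rw [← ae_iff (p := fun x => ∀ j, PWZExists φ (α j) (ρ • x))]
    filter_upwards [hae] with x hx j
    -- Scaling is the case ρ x + 0 x of linearity, so the same full-measure set serves every ρ.
    have h := (hx j).tendsto_linear hT.le (hx j) ρ 0
    rw [zero_smul, add_zero] at h
    exact ⟨_, h⟩
  have hlim : ∀ᵐ x ∂m, ∀ j, Tendsto (pwzApprox φ (α j) (γ • x + β • y)) atTop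
      (𝓝 (γ * pwz φ (α j) x + β * pwz φ (α j) y)) := by
    filter_upwards [hae] with x hx j
    exact (hx j).tendsto_linear hT.le (hy j) γ β
  have hF : (fun x => polyFunctional φ α p (γ • x + β • y)) =ᵐ[m]
      fun x => ∏ j, (γ * pwz φ (α j) x + β * pwz φ (α j) y) ^ (2 * p j) := by
    filter_upwards [hlim] with x hx
    exact Finset.prod_congr rfl fun j _ => by rw [pwz, (hx j).limUnder_eq]
  have hstd := isStdGaussianFamily_pwz hT.le hm φ hα
  have hX : ∀ j, AEMeasurable (fun x => pwz φ (α j) x) m := fun j =>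
    aemeasurable_of_tendsto_metrizable_ae atTop
      (fun N => (measurable_pwzApprox hT.le φ (α j) N).aemeasurable) <| by
        filter_upwards [hae] with x hx using (hx j).tendsto
  have hind := hstd.iIndepFun hX
  have hmom := fun j => integral_affine_pow_gaussianReal (p j) γ (β * pwz φ (α j) y)
  refine ⟨?_, ?_, ?_⟩
  · filter_upwards [hlim] with x hx j using ⟨_, hx j⟩
  · rw [integrable_congr hF]
    -- By independence the joint law is a product of standard Gaussians, under which a product of
    -- integrable functions of separate coordinates is integrable.
    have hpi := hind.map_fun_eq_pi_map hX
    simp only [hstd.map_eq] at hpi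
    have h := Integrable.fintype_prod fun j => (hmom j).1
    rw [← hpi] at h
    exact h.comp_aemeasurable (aemeasurable_pi_lambda _ hX)
  · rw [integral_congr_ae hF, hind.integral_fun_prod_comp (f := fun j u =>
      (γ * u + β * pwz φ (α j) y) ^ (2 * p j)) hX fun j => by fun_prop]
    refine Finset.prod_congr rfl fun j _ => ?_
    rw [← integral_map (f := fun u => (γ * u + β * pwz φ (α j) y) ^ (2 * p j)) (hX j)
      (by fun_prop), hstd.map_eq, (hmom j).2]
    exact Finset.sum_congr rfl fun s _ => by rw [mul_pow]; ring
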